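/- For each $n\ge 1$ let $p=p_n\in\mathbb{N}$ and let $\mathbf X_1,\dots,\mathbf X_n$ be i.i.d. $N(\mathbf 0,\mathbf\Sigma)$ random vectors in $\mathbb{R}^p$, where $\mathbf\Sigma=\mathbf\Sigma_n$ is a (possibly singular) $p\times p$ covariance matrix with $\Sigma_{jj}=1$ for all $j$. Put $\mathbf A_{ik}=\operatorname{sign}(\mathbf X_i-\mathbf X_k)\in\mathbb{R}^p$ (coordinatewise) and $\mathbf A_i=\mathbb{E}\{\mathbf A_{ik}\mid \mathbf X_i\}$ for $k\neq i$ (which, up to null sets, does not depend on $k$). Define the improved (Hoeffding) Spearman rank correlation matrix $$\tilde{\boldsymbol\rho}_n=\frac{3}{n(n-1)(n-2)}\sum_{i,j,k\ \text{mutually different}}\mathbf A_{ij}\mathbf A_{ik}^\top \quad (n\ge 3)$$ and $$\mathbf W_n=\frac{3}{n}\sum_{i=1}^n\mathbf A_i\mathbf A_i^\top \quad (n\ge 2).$$ For a symmetric $p\times p$ matrix $\mathbf H$ with eigenvalues $\lambda_1,\dots,\lambda_p$ let $F^{\mathbf H}(x)=\frac1p\sum_{i=1}^p I(\lambda_i\le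 x)$ be its empirical spectral distribution, and for distribution functions $F,G$ on $\mathbb{R}$ let $$L(F,G)=\inf\{\varepsilon>0:\ F(x-\varepsilon)-\varepsilon\le G(x)\le F(x+\varepsilon)+\varepsilon\ \text{for all } x\in\mathbb{R}\}$$ be the Lévy distance. If, as $n\to\infty$, (i) $p/n\to y\in(0,\infty)$, and (ii) $\operatorname{tr}(\mathbf\Sigma^2)=o(p^2)$, then $L\left(F^{\tilde{\boldsymbol\rho}_n},F^{\mathbf W_n}\right)\to 0$ in probability, i.e. for every $\varepsilon>0$, $\Pr\left(L(F^{\tilde{\boldsymbol\rho}_n},F^{\mathbf W_n})\ge\varepsilon\right)\to 0$. -/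

import Mathlib

open MeasureTheory ProbabilityTheory Filter Topology Asymptotics

namespace SpearmanLSD

noncomputable section

/-- Empirical spectral distribution function of a real symmetric `p × p` matrix:
the proportion of eigenvalues (with multiplicity) that are at most `x`. -/
def esd {p : ℕ} {M : Matrix (Fin p) (Fin p) ℝ} (hM : M.IsHermitian) (x : ℝ) : ℝ :=
  (∑ i : Fin p, if hM.eigenvalues i ≤ x then (1 : ℝ) else 0) / (p : ℝ)

/-- Lévy distance between two distribution functions on the real line. -/
def levyDist (F G : ℝ → ℝ) : ℝ :=
  sInf {ε : ℝ | 0 < ε ∧ ∀ x : ℝ, F (x - ε) - ε ≤ G x ∧ G x ≤ F (x + ε) + ε}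

variable {Ω : Type*} {n p : ℕ}

/-- The sign vector `A_{ik} = sign (X_i - X_k)`, taken coordinatewise. -/
def signVec (X : Fin n → Ω → EuclideanSpace ℝ (Fin p)) (i k : Fin n) (ω : Ω) : Fin p → ℝ :=
  fun j => Real.sign (X i ω j - X k ω j)

/-- The conditional expectation `E[A_{ik} | X_i]`, taken coordinatewise. -/
def condSignVec [MeasurableSpace Ω] (P : Measure Ω)
    (X : Fin n → Ω → EuclideanSpace ℝ (Fin p)) (i k : Fin n) (ω : Ω) : Fin p → ℝ :=
  fun j => (P[fun ω' => signVec X i k ω' j |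
    MeasurableSpace.comap (X i) (inferInstance : MeasurableSpace (EuclideanSpace ℝ (Fin p)))]) ω

/-- Hoeffding's improved Spearman rank correlation matrix
`3 / (n (n-1) (n-2)) ∑ A_{ij} A_{ik}ᵀ`, the sum over mutually different `i, j, k`. -/
def improvedSpearman (X : Fin n → Ω → EuclideanSpace ℝ (Fin p)) (ω : Ω) :
    Matrix (Fin p) (Fin p) ℝ :=
  (3 / ((n : ℝ) * ((n : ℝ) - 1) * ((n : ℝ) - 2))) •
    ∑ i : Fin n, ∑ j : Fin n, ∑ k : Fin n,
      if i ≠ j ∧ i ≠ k ∧ j ≠ k then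
        Matrix.vecMulVec (signVec X i j ω) (signVec X i k ω)
      else 0

/-- The matrix `W_n = (3 / n) ∑ A_i A_iᵀ`, where `A_i = E[A_{ik} | X_i]` and `k = κ i` is an index
different from `i`. For i.i.d. `X_i` the choice of `k` does not matter, up to null sets. -/
def projMatrix [MeasurableSpace Ω] (P : Measure Ω)
    (X : Fin n → Ω → EuclideanSpace ℝ (Fin p)) (κ : Fin n → Fin n) (ω : Ω) :
    Matrix (Fin p) (Fin p) ℝ :=
  (3 / (n : ℝ)) •
    ∑ i : Fin n, Matrix.vecMulVec (condSignVec P X i (κ i) ω) (condSignVec P X i (κ i) ω)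

theorem improvedSpearman_isHermitian (X : Fin n → Ω → EuclideanSpace ℝ (Fin p)) (ω : Ω) :
    (improvedSpearman X ω).IsHermitian := by
  ext a b
  simp only [improvedSpearman, Matrix.conjTranspose_apply, Matrix.smul_apply, Matrix.sum_apply,
    star_trivial]
  congr 1
  refine Finset.sum_congr rfl fun i _ => ?_
  rw [Finset.sum_comm]
  refine Finset.sum_congr rfl fun j _ => Finset.sum_congr rfl fun k _ => ?_
  by_cases h : i ≠ k ∧ i ≠ j ∧ k ≠ j
  · have h' : i ≠ j ∧ i ≠ k ∧ j ≠ k := ⟨h.2.1, h.1, h.2.2.symm⟩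
    rw [if_pos h, if_pos h']
    simp [Matrix.vecMulVec_apply, mul_comm]
  · have h' : ¬ (i ≠ j ∧ i ≠ k ∧ j ≠ k) := fun h' => h ⟨h'.2.1, h'.1, h'.2.2.symm⟩
    rw [if_neg h, if_neg h']
    simp

theorem projMatrix_isHermitian [MeasurableSpace Ω] (P : Measure Ω)
    (X : Fin n → Ω → EuclideanSpace ℝ (Fin p)) (κ : Fin n → Fin n) (ω : Ω) :
    (projMatrix P X κ ω).IsHermitian := by
  ext a b
  simp [projMatrix, Matrix.sum_apply, Matrix.vecMulVec_apply, mul_comm]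

end

end SpearmanLSD

/-!
Up to negligible terms both matrices are Gram matrices, and their rows are so close on average that
the trace norm of the difference of the matrices is of smaller order than `p`.

Summing over `j ≠ k` first, the improved Spearman matrix equals `(n - 1) / (n - 2)` times the matrix
`(3 / n) ∑ Uᵢ Uᵢᵀ` of the row means `Uᵢ = (n - 1)⁻¹ ∑_{j ≠ i} A_{ij}`, minus a positive semidefinite
matrix of trace at most `3 p / (n - 2)`. So the task is to compare `(3 / n) ∑ Uᵢ Uᵢᵀ` with
`W = (3 / n) ∑ Aᵢ Aᵢᵀ`. Given `Xᵢ`, the entries of `Uᵢ` are means of `n - 1` variables that are conditionally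
independent, bounded by one, and have the entries of `Aᵢ` as conditional expectations; hence
`𝔼 ∑ ‖Uᵢ - Aᵢ‖² ≤ 4 n p / (n - 1)` (`integral_rowError_le`).

For an orthonormal basis `v₁, …, v_p` the inequality
`|⟨v, U⟩² - ⟨v, A⟩²| ≤ (1 + t) ⟨v, U - A⟩² + ⟨v, U⟩² / t` and Parseval's identity bound
`∑ₗ |vₗᵀ (ρ̃ - W) vₗ|` by `(3 / n) (1 + t) ∑ ‖Uᵢ - Aᵢ‖² + (3 / t + 6 / (n - 2)) p`
(`sum_abs_dotProduct_sub_mulVec_le`). With `t = √n` this is `o(p)` in probability.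

For the eigenbasis of `ρ̃ - W` the sum is the trace norm of `ρ̃ - W`. If it is at most `ε² p`, then
at most `ε p` eigenvalues of `ρ̃ - W` exceed `ε` in absolute value, and a dimension count in the style
of Weyl's inequalities (`card_eigenvalues_le_add`) shows that the Lévy distance is at most `ε`
(`levyDist_esd_le`).
-/

namespace SpearmanLSD

/-! ### Spectral perturbation and the Lévy distance -/

section Spectral

variable {p : ℕ} {A B : Matrix (Fin p) (Fin p) ℝ}

theorem dotProduct_mulVec_eq_sum_eigenvalues (hA : A.IsHermitian)
    (v : EuclideanSpace ℝ (Fin p)) :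
    v.ofLp ⬝ᵥ A.mulVec v.ofLp =
      ∑ i, hA.eigenvalues i * inner ℝ (hA.eigenvectorBasis i) v ^ 2 := by
  have hinner : ∀ x y : EuclideanSpace ℝ (Fin p), inner ℝ x y = x.ofLp ⬝ᵥ y.ofLp := fun x y => by
    rw [EuclideanSpace.inner_eq_star_dotProduct, star_trivial, dotProduct_comm]
  have key : ∀ i, inner ℝ (hA.eigenvectorBasis i) (WithLp.toLp 2 (A.mulVec v.ofLp)) =
      hA.eigenvalues i * inner ℝ (hA.eigenvectorBasis i) v := fun i => by
    have hT : A.transpose = A := by simpa [Matrix.IsHermitian] using hA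
    rw [hinner, hinner, Matrix.dotProduct_mulVec, ← Matrix.mulVec_transpose, hT,
      hA.mulVec_eigenvectorBasis, smul_dotProduct, smul_eq_mul]
  calc v.ofLp ⬝ᵥ A.mulVec v.ofLp = inner ℝ v (WithLp.toLp 2 (A.mulVec v.ofLp)) := by rw [hinner]
    _ = ∑ i, inner ℝ v (hA.eigenvectorBasis i) *
          inner ℝ (hA.eigenvectorBasis i) (WithLp.toLp 2 (A.mulVec v.ofLp)) :=
        (hA.eigenvectorBasis.sum_inner_mul_inner _ _).symm
    _ = _ := Finset.sum_congr rfl fun i _ => by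
        rw [key, real_inner_comm]; ring

theorem sum_inner_sq_eq_sum_sq (b : OrthonormalBasis (Fin p) ℝ (EuclideanSpace ℝ (Fin p)))
    (v : EuclideanSpace ℝ (Fin p)) : ∑ i, inner ℝ (b i) v ^ 2 = ∑ j, v j ^ 2 := by
  have := b.sum_sq_norm_inner_right v
  simpa [EuclideanSpace.norm_sq_eq] using this

/-- An inequality of Weyl type for eigenvalue counts: if the quadratic form of `B` exceeds that of
`A` by a form that is diagonal in the orthonormal basis `b`, with coefficients `d`, then at most
`#{l | ε < d l}` eigenvalues can rise from below `x - ε` to above `x`. Otherwise the linear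
conditions "orthogonal to the eigenvectors of `A` above `x - ε`, to the `b l` with `ε < d l`, and to
the eigenvectors of `B` below `x`" would be fewer than `p`, and a nonzero solution of them would
violate the identity of quadratic forms. -/
theorem card_eigenvalues_le_add (hA : A.IsHermitian) (hB : B.IsHermitian)
    (b : OrthonormalBasis (Fin p) ℝ (EuclideanSpace ℝ (Fin p))) (d : Fin p → ℝ)
    (hd : ∀ v : EuclideanSpace ℝ (Fin p), v.ofLp ⬝ᵥ B.mulVec v.ofLp =
      v.ofLp ⬝ᵥ A.mulVec v.ofLp + ∑ l, d l * inner ℝ (b l) v ^ 2) (x ε : ℝ) :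
    (Finset.univ.filter fun i => hA.eigenvalues i ≤ x - ε).card ≤
      (Finset.univ.filter fun i => hB.eigenvalues i ≤ x).card +
        (Finset.univ.filter fun l => ε < d l).card := by
  by_contra! hlt
  have hsplit := Finset.card_filter_add_card_filter_not (s := (Finset.univ : Finset (Fin p)))
    (fun i => hA.eigenvalues i ≤ x - ε)
  rw [Finset.card_univ, Fintype.card_fin] at hsplit
  let J := ({i // ¬ hA.eigenvalues i ≤ x - ε} ⊕ {l // ε < d l}) ⊕ {i // hB.eigenvalues i ≤ x}
  let u : J → EuclideanSpace ℝ (Fin p) :=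
    Sum.elim (Sum.elim (fun i => hA.eigenvectorBasis i) fun l => b l) fun i => hB.eigenvectorBasis i
  let φ : EuclideanSpace ℝ (Fin p) →ₗ[ℝ] (J → ℝ) :=
    LinearMap.pi fun k => (innerSL ℝ (u k)).toLinearMap
  have hφ : LinearMap.ker φ ≠ ⊥ := by
    apply LinearMap.ker_ne_bot_of_finrank_lt
    rw [Module.finrank_fintype_fun_eq_card, finrank_euclideanSpace_fin]
    simp only [J, Fintype.card_sum, Fintype.card_subtype]
    omega
  obtain ⟨v, hv, hv0⟩ := (Submodule.ne_bot_iff _).1 hφ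
  have hu : ∀ k, inner ℝ (u k) v = 0 := fun k => by
    simpa [φ] using congrFun (LinearMap.mem_ker.1 hv) k
  have hApart : v.ofLp ⬝ᵥ A.mulVec v.ofLp ≤ (x - ε) * ∑ j, v j ^ 2 := by
    rw [dotProduct_mulVec_eq_sum_eigenvalues hA, ← sum_inner_sq_eq_sum_sq hA.eigenvectorBasis,
      Finset.mul_sum]
    refine Finset.sum_le_sum fun i _ => ?_
    by_cases hi : hA.eigenvalues i ≤ x - ε
    · exact mul_le_mul_of_nonneg_right hi (sq_nonneg _)
    · have : inner ℝ (hA.eigenvectorBasis i) v = 0 := hu (Sum.inl (Sum.inl ⟨i, hi⟩))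
      simp [this]
  have hDpart : ∑ l, d l * inner ℝ (b l) v ^ 2 ≤ ε * ∑ j, v j ^ 2 := by
    rw [← sum_inner_sq_eq_sum_sq b, Finset.mul_sum]
    refine Finset.sum_le_sum fun l _ => ?_
    by_cases hl : ε < d l
    · have : inner ℝ (b l) v = 0 := hu (Sum.inl (Sum.inr ⟨l, hl⟩))
      simp [this]
    · exact mul_le_mul_of_nonneg_right (not_lt.1 hl) (sq_nonneg _)
  have hBpart : x * ∑ j, v j ^ 2 < v.ofLp ⬝ᵥ B.mulVec v.ofLp := by
    rw [dotProduct_mulVec_eq_sum_eigenvalues hB, ← sum_inner_sq_eq_sum_sq hB.eigenvectorBasis,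
      Finset.mul_sum]
    have hzero : ∀ i, hB.eigenvalues i ≤ x → inner ℝ (hB.eigenvectorBasis i) v = 0 :=
      fun i hi => hu (Sum.inr ⟨i, hi⟩)
    obtain ⟨i, hi⟩ : ∃ i, inner ℝ (hB.eigenvectorBasis i) v ≠ 0 := by
      by_contra! h
      exact hv0 (by rw [← hB.eigenvectorBasis.sum_repr' v]; simp [h])
    refine Finset.sum_lt_sum (fun k _ => ?_) ⟨i, Finset.mem_univ _, ?_⟩
    · by_cases hk : hB.eigenvalues k ≤ x
      · simp [hzero k hk]
      · exact mul_le_mul_of_nonneg_right (not_le.1 hk).le (sq_nonneg _)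
    · exact mul_lt_mul_of_pos_right (not_le.1 fun h => hi (hzero i h)) (by positivity)
  have := hd v
  nlinarith

/-- Markov's inequality for the counting measure. -/
theorem card_lt_le_of_sum_abs_le {d : Fin p → ℝ} {ε : ℝ} (hε : 0 < ε)
    (hsum : ∑ l, |d l| ≤ ε ^ 2 * p) :
    ((Finset.univ.filter fun l => ε < d l).card : ℝ) ≤ ε * p := by
  have h : ((Finset.univ.filter fun l => ε < d l).card : ℝ) * ε ≤ ∑ l, |d l| := by
    calc ((Finset.univ.filter fun l => ε < d l).card : ℝ) * ε
        = ∑ l ∈ Finset.univ.filter fun l => ε < d l, ε := by simp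
      _ ≤ ∑ l ∈ Finset.univ.filter fun l => ε < d l, |d l| :=
          Finset.sum_le_sum fun l hl => ((Finset.mem_filter.1 hl).2.le).trans (le_abs_self _)
      _ ≤ ∑ l, |d l| := Finset.sum_le_sum_of_subset_of_nonneg (Finset.filter_subset _ _)
          fun _ _ _ => abs_nonneg _
  nlinarith

theorem esd_sub_le (hA : A.IsHermitian) (hB : B.IsHermitian)
    (b : OrthonormalBasis (Fin p) ℝ (EuclideanSpace ℝ (Fin p))) (d : Fin p → ℝ)
    (hd : ∀ v : EuclideanSpace ℝ (Fin p), v.ofLp ⬝ᵥ B.mulVec v.ofLp =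
      v.ofLp ⬝ᵥ A.mulVec v.ofLp + ∑ l, d l * inner ℝ (b l) v ^ 2)
    {ε : ℝ} (hε : 0 < ε) (hsum : ∑ l, |d l| ≤ ε ^ 2 * p) (x : ℝ) :
    esd hA (x - ε) ≤ esd hB x + ε := by
  rcases Nat.eq_zero_or_pos p with rfl | hp
  · simpa [esd] using hε.le
  have hp' : (0 : ℝ) < p := by exact_mod_cast hp
  have h1 : ((Finset.univ.filter fun i => hA.eigenvalues i ≤ x - ε).card : ℝ) ≤
      (Finset.univ.filter fun i => hB.eigenvalues i ≤ x).card +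
        (Finset.univ.filter fun l => ε < d l).card := by
    exact_mod_cast card_eigenvalues_le_add hA hB b d hd x ε
  have h2 := card_lt_le_of_sum_abs_le hε hsum
  rw [esd, esd, Finset.sum_boole, Finset.sum_boole, div_add' _ _ _ hp'.ne']
  gcongr
  linarith

/-- The Lévy distance of two empirical spectral distributions is controlled by the trace norm of
the difference `D` of the matrices; the trace norm is written as the sum of `|vᵀ D v|` over an
orthonormal basis of eigenvectors of `D`. -/
theorem levyDist_esd_le (hA : A.IsHermitian) (hB : B.IsHermitian) (hD : (A - B).IsHermitian)
    {ε : ℝ} (hε : 0 < ε)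
    (hsum : ∑ l, |(hD.eigenvectorBasis l).ofLp ⬝ᵥ
      (A - B).mulVec (hD.eigenvectorBasis l).ofLp| ≤ ε ^ 2 * p) :
    levyDist (esd hA) (esd hB) ≤ ε := by
  have heig : ∀ l, (hD.eigenvectorBasis l).ofLp ⬝ᵥ
      (A - B).mulVec (hD.eigenvectorBasis l).ofLp = hD.eigenvalues l := fun l => by
    simpa using (hD.eigenvalues_eq l).symm
  simp only [heig] at hsum
  have hform : ∀ v : EuclideanSpace ℝ (Fin p), v.ofLp ⬝ᵥ A.mulVec v.ofLp =
      v.ofLp ⬝ᵥ B.mulVec v.ofLp +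
        ∑ l, hD.eigenvalues l * inner ℝ (hD.eigenvectorBasis l) v ^ 2 := fun v => by
    rw [← dotProduct_mulVec_eq_sum_eigenvalues hD, Matrix.sub_mulVec, dotProduct_sub]; ring
  refine csInf_le ⟨0, fun _ h => h.1.le⟩ ⟨hε, fun x => ⟨?_, ?_⟩⟩
  · have := esd_sub_le hA hB hD.eigenvectorBasis (fun l => -hD.eigenvalues l)
      (fun v => by simp [hform v]) hε (by simpa using hsum) x
    linarith
  · simpa using esd_sub_le hB hA hD.eigenvectorBasis _ hform hε hsum (x + ε)

end Spectral

/-! ### The trace norm of the difference of the two matrices -/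

section Deterministic

variable {n p : ℕ}

theorem sum_distinct_mul_eq (i : Fin n) (α : Fin n → ℝ) :
    (∑ j, ∑ k, if i ≠ j ∧ i ≠ k ∧ j ≠ k then α j * α k else 0) =
      (∑ j ∈ Finset.univ.erase i, α j) ^ 2 - ∑ j ∈ Finset.univ.erase i, α j ^ 2 := by
  have h : ∀ j ∈ Finset.univ.erase i, ∑ k ∈ Finset.univ.erase i, α j * α k =
      (∑ k ∈ Finset.univ.erase i, if j ≠ k then α j * α k else 0) + α j ^ 2 := fun j hj => by
    have hdiag : α j ^ 2 = ∑ k ∈ Finset.univ.erase i, if j = k then α j * α k else 0 := by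
      rw [Finset.sum_ite_eq, if_pos hj, sq]
    rw [hdiag, ← Finset.sum_add_distrib]
    refine Finset.sum_congr rfl fun k _ => ?_
    by_cases hjk : j = k <;> simp [hjk]
  rw [sq, Finset.sum_mul_sum, Finset.sum_congr rfl h, Finset.sum_add_distrib, add_sub_cancel_right]
  have herase : ∀ f : Fin n → ℝ, ∑ j ∈ Finset.univ.erase i, f j = ∑ j, if i ≠ j then f j else 0 :=
    fun f => by
      rw [← Finset.sum_filter]; congr 1; ext j; simp [eq_comm]
  simp only [herase]
  refine Finset.sum_congr rfl fun j _ => ?_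
  by_cases hij : i = j
  · simp [hij]
  · simp only [hij, ne_eq, not_false_eq_true, true_and, if_true]
    refine Finset.sum_congr rfl fun k _ => ?_
    by_cases hik : i = k <;> simp [hik]

theorem dotProduct_vecMulVec_mulVec (v u w : Fin p → ℝ) :
    v ⬝ᵥ (Matrix.vecMulVec u w).mulVec v = (v ⬝ᵥ u) * (v ⬝ᵥ w) := by
  rw [Matrix.vecMulVec_mulVec]
  simp [dotProduct_comm w v, mul_comm]

/-- Young's inequality applied to `u² - γ² = 2 u (u - γ) - (u - γ)²`; the bound does not
involve the size of `γ`. -/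
theorem abs_sq_sub_sq_le (u γ : ℝ) {t : ℝ} (ht : 0 < t) :
    |u ^ 2 - γ ^ 2| ≤ (1 + t) * (u - γ) ^ 2 + u ^ 2 / t := by
  have h : t * (u - γ) ^ 2 + u ^ 2 / t - 2 * (u * (u - γ)) = (t * (u - γ) - u) ^ 2 / t := by
    field_simp; ring
  have h' : t * (u - γ) ^ 2 + u ^ 2 / t + 2 * (u * (u - γ)) = (t * (u - γ) + u) ^ 2 / t := by
    field_simp; ring
  have h1 : 0 ≤ (t * (u - γ) - u) ^ 2 / t := by positivity
  have h2 : 0 ≤ (t * (u - γ) + u) ^ 2 / t := by positivity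
  rw [abs_le]
  constructor <;> nlinarith [sq_nonneg (u - γ)]

/-- The normalized sum of `a i j (a i k)ᵀ` over mutually different `i, j, k`, for a doubly indexed
family of vectors; `improvedSpearman` is the case of the sign vectors. -/
noncomputable def distinctTripleMatrix (a : Fin n → Fin n → Fin p → ℝ) :
    Matrix (Fin p) (Fin p) ℝ :=
  (3 / ((n : ℝ) * ((n : ℝ) - 1) * ((n : ℝ) - 2))) •
    ∑ i : Fin n, ∑ j : Fin n, ∑ k : Fin n,
      if i ≠ j ∧ i ≠ k ∧ j ≠ k then Matrix.vecMulVec (a i j) (a i k) else 0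

/-- The matrix `(3 / n) ∑ g i (g i)ᵀ`; `projMatrix` is the case of the conditional expectations of
the sign vectors. -/
noncomputable def gramMatrix (g : Fin n → Fin p → ℝ) : Matrix (Fin p) (Fin p) ℝ :=
  (3 / (n : ℝ)) • ∑ i : Fin n, Matrix.vecMulVec (g i) (g i)

/-- The row means `(n - 1)⁻¹ ∑_{j ≠ i} a i j`. -/
noncomputable def rowMean (a : Fin n → Fin n → Fin p → ℝ) (i : Fin n) : Fin p → ℝ :=
  fun l => (∑ j ∈ Finset.univ.erase i, a i j l) / ((n : ℝ) - 1)

/-- The quadratic form of the difference. The distinct-triple matrix is `(n - 1) / (n - 2)` times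
the Gram matrix of the row means, minus a diagonal contribution. -/
theorem abs_dotProduct_sub_mulVec_le (hn : 3 ≤ n) (a : Fin n → Fin n → Fin p → ℝ)
    (g : Fin n → Fin p → ℝ) (v : Fin p → ℝ) {t : ℝ} (ht : 0 < t) :
    |v ⬝ᵥ (distinctTripleMatrix a - gramMatrix g).mulVec v| ≤
      (3 / (n : ℝ)) * (1 + t) * ∑ i, (v ⬝ᵥ (rowMean a i - g i)) ^ 2 +
      ((3 / (n : ℝ)) / t + 3 / ((n : ℝ) * ((n : ℝ) - 2))) * ∑ i, (v ⬝ᵥ rowMean a i) ^ 2 +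
      3 / ((n : ℝ) * ((n : ℝ) - 1) * ((n : ℝ) - 2)) *
        ∑ i, ∑ j ∈ Finset.univ.erase i, (v ⬝ᵥ a i j) ^ 2 := by
  have hn' : (3 : ℝ) ≤ n := by exact_mod_cast hn
  have h0 : (0 : ℝ) < n := by linarith
  have h1 : (0 : ℝ) < n - 1 := by linarith
  have h2 : (0 : ℝ) < n - 2 := by linarith
  have hrow : ∀ i, v ⬝ᵥ rowMean a i =
      (∑ j ∈ Finset.univ.erase i, v ⬝ᵥ a i j) / ((n : ℝ) - 1) := fun i => by
    simp only [rowMean, dotProduct]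
    rw [Finset.sum_comm, Finset.sum_div]
    exact Finset.sum_congr rfl fun l _ => by rw [← Finset.mul_sum, mul_div_assoc]
  have hT : v ⬝ᵥ (distinctTripleMatrix a).mulVec v =
      3 / ((n : ℝ) * ((n : ℝ) - 1) * ((n : ℝ) - 2)) *
        ∑ i, (((n : ℝ) - 1) ^ 2 * (v ⬝ᵥ rowMean a i) ^ 2 -
          ∑ j ∈ Finset.univ.erase i, (v ⬝ᵥ a i j) ^ 2) := by
    have : ∀ i, ((n : ℝ) - 1) ^ 2 * (v ⬝ᵥ rowMean a i) ^ 2 -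
        ∑ j ∈ Finset.univ.erase i, (v ⬝ᵥ a i j) ^ 2 =
        ∑ j, ∑ k, if i ≠ j ∧ i ≠ k ∧ j ≠ k then (v ⬝ᵥ a i j) * (v ⬝ᵥ a i k) else 0 := fun i => by
      rw [sum_distinct_mul_eq i fun j => v ⬝ᵥ a i j, hrow]
      field_simp
    simp only [this, distinctTripleMatrix, Matrix.smul_mulVec, dotProduct_smul, smul_eq_mul,
      Matrix.sum_mulVec, dotProduct_sum]
    congr 1
    refine Finset.sum_congr rfl fun i _ => Finset.sum_congr rfl fun j _ =>
      Finset.sum_congr rfl fun k _ => ?_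
    split_ifs <;> simp [dotProduct_vecMulVec_mulVec]
  have hG : v ⬝ᵥ (gramMatrix g).mulVec v = (3 / (n : ℝ)) * ∑ i, (v ⬝ᵥ g i) ^ 2 := by
    simp only [gramMatrix, Matrix.smul_mulVec, dotProduct_smul, smul_eq_mul,
      Matrix.sum_mulVec, dotProduct_sum, dotProduct_vecMulVec_mulVec, sq]
  -- `(n - 1) / (n - 2) = 1 + 1 / (n - 2)`
  have hsplit : v ⬝ᵥ (distinctTripleMatrix a - gramMatrix g).mulVec v =
      (3 / (n : ℝ)) * ∑ i, ((v ⬝ᵥ rowMean a i) ^ 2 - (v ⬝ᵥ g i) ^ 2) +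
      3 / ((n : ℝ) * ((n : ℝ) - 2)) * ∑ i, (v ⬝ᵥ rowMean a i) ^ 2 -
      3 / ((n : ℝ) * ((n : ℝ) - 1) * ((n : ℝ) - 2)) *
        ∑ i, ∑ j ∈ Finset.univ.erase i, (v ⬝ᵥ a i j) ^ 2 := by
    rw [Matrix.sub_mulVec, dotProduct_sub, hT, hG, Finset.sum_sub_distrib, Finset.sum_sub_distrib,
      ← Finset.mul_sum]
    field_simp
    ring
  have habs : |∑ i, ((v ⬝ᵥ rowMean a i) ^ 2 - (v ⬝ᵥ g i) ^ 2)| ≤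
      (1 + t) * ∑ i, (v ⬝ᵥ (rowMean a i - g i)) ^ 2 + (∑ i, (v ⬝ᵥ rowMean a i) ^ 2) / t := by
    refine (Finset.abs_sum_le_sum_abs _ _).trans ?_
    rw [Finset.mul_sum, Finset.sum_div, ← Finset.sum_add_distrib]
    refine Finset.sum_le_sum fun i _ => ?_
    rw [dotProduct_sub]
    exact abs_sq_sub_sq_le _ _ ht
  have hpos2 : 0 ≤ 3 / ((n : ℝ) * ((n : ℝ) - 2)) * ∑ i, (v ⬝ᵥ rowMean a i) ^ 2 := by positivity
  have hpos3 : 0 ≤ 3 / ((n : ℝ) * ((n : ℝ) - 1) * ((n : ℝ) - 2)) *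
      ∑ i, ∑ j ∈ Finset.univ.erase i, (v ⬝ᵥ a i j) ^ 2 := by positivity
  rw [hsplit]
  refine (abs_sub _ _).trans ?_
  rw [abs_of_nonneg hpos3]
  gcongr
  refine (abs_add_le _ _).trans ?_
  rw [abs_of_nonneg hpos2, abs_mul, abs_of_pos (by positivity : 0 < 3 / (n : ℝ))]
  have := mul_le_mul_of_nonneg_left habs (by positivity : 0 ≤ 3 / (n : ℝ))
  calc _ ≤ _ := add_le_add_left this _
    _ = _ := by ring

theorem sum_dotProduct_sq_eq (b : OrthonormalBasis (Fin p) ℝ (EuclideanSpace ℝ (Fin p)))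
    (w : Fin p → ℝ) : ∑ l, ((b l).ofLp ⬝ᵥ w) ^ 2 = ∑ j, w j ^ 2 := by
  rw [← sum_inner_sq_eq_sum_sq b (WithLp.toLp 2 w)]
  refine Finset.sum_congr rfl fun l _ => ?_
  rw [EuclideanSpace.inner_eq_star_dotProduct, star_trivial, dotProduct_comm]

/-- Summing the quadratic form over an orthonormal basis turns every square into a squared
Euclidean norm, by Parseval's identity. -/
theorem sum_abs_dotProduct_sub_mulVec_le (hn : 3 ≤ n) (a : Fin n → Fin n → Fin p → ℝ)
    (ha : ∀ i j l, |a i j l| ≤ 1) (g : Fin n → Fin p → ℝ)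
    (b : OrthonormalBasis (Fin p) ℝ (EuclideanSpace ℝ (Fin p))) {t : ℝ} (ht : 0 < t) :
    ∑ l, |(b l).ofLp ⬝ᵥ (distinctTripleMatrix a - gramMatrix g).mulVec (b l).ofLp| ≤
      (3 / (n : ℝ)) * (1 + t) * (∑ i, ∑ j, (rowMean a i j - g i j) ^ 2) +
        (3 / t + 6 / ((n : ℝ) - 2)) * p := by
  have hn' : (3 : ℝ) ≤ n := by exact_mod_cast hn
  have h0 : (0 : ℝ) < n := by linarith
  have h1 : (0 : ℝ) < n - 1 := by linarith
  have h2 : (0 : ℝ) < n - 2 := by linarith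
  have hcard : ∀ i : Fin n, (((Finset.univ.erase i).card : ℕ) : ℝ) = (n : ℝ) - 1 := fun i => by
    rw [Finset.card_erase_of_mem (Finset.mem_univ i), Finset.card_univ, Fintype.card_fin,
      Nat.cast_pred (by omega)]
  have hrow : ∀ i j, rowMean a i j ^ 2 ≤ 1 := fun i j => by
    rw [sq_le_one_iff_abs_le_one, rowMean, abs_div, abs_of_pos h1, div_le_one h1, ← hcard i]
    refine (Finset.abs_sum_le_sum_abs _ _).trans ?_
    exact (Finset.sum_le_card_nsmul _ _ 1 fun k _ => ha i k j).trans_eq (by rw [nsmul_one])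
  have hrows : ∑ i, ∑ j, rowMean a i j ^ 2 ≤ n * p := by
    calc ∑ i, ∑ j, rowMean a i j ^ 2 ≤ ∑ _i : Fin n, ∑ _j : Fin p, (1 : ℝ) :=
          Finset.sum_le_sum fun i _ => Finset.sum_le_sum fun j _ => hrow i j
      _ = n * p := by simp
  have haa : ∑ i, ∑ j ∈ Finset.univ.erase i, ∑ l, a i j l ^ 2 ≤ n * (n - 1) * p := by
    calc ∑ i, ∑ j ∈ Finset.univ.erase i, ∑ l, a i j l ^ 2
        ≤ ∑ i : Fin n, ∑ _j ∈ Finset.univ.erase i, ∑ _l : Fin p, (1 : ℝ) :=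
          Finset.sum_le_sum fun i _ => Finset.sum_le_sum fun j _ => Finset.sum_le_sum fun l _ =>
            (sq_le_one_iff_abs_le_one _).2 (ha i j l)
      _ = n * (n - 1) * p := by simp [hcard, ← mul_assoc, -Finset.card_erase_of_mem]
  refine (Finset.sum_le_sum fun l _ =>
    abs_dotProduct_sub_mulVec_le hn a g (b l).ofLp ht).trans ?_
  rw [Finset.sum_add_distrib, Finset.sum_add_distrib, ← Finset.mul_sum, ← Finset.mul_sum,
    ← Finset.mul_sum, Finset.sum_comm,
    Finset.sum_comm (f := fun l i => ((b l).ofLp ⬝ᵥ rowMean a i) ^ 2),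
    Finset.sum_comm (f := fun l i => ∑ j ∈ Finset.univ.erase i, ((b l).ofLp ⬝ᵥ a i j) ^ 2)]
  simp only [Finset.sum_comm (s := Finset.univ) (t := Finset.univ.erase _), sum_dotProduct_sq_eq]
  have e1 : ((3 / (n : ℝ)) / t + 3 / ((n : ℝ) * ((n : ℝ) - 2))) *
      ∑ i, ∑ j, rowMean a i j ^ 2 ≤ (3 / t + 3 / ((n : ℝ) - 2)) * p := by
    calc _ ≤ ((3 / (n : ℝ)) / t + 3 / ((n : ℝ) * ((n : ℝ) - 2))) * (n * p) := by gcongr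
      _ = _ := by field_simp
  have e2 : 3 / ((n : ℝ) * ((n : ℝ) - 1) * ((n : ℝ) - 2)) *
      ∑ i, ∑ j ∈ Finset.univ.erase i, ∑ l, a i j l ^ 2 ≤ 3 / ((n : ℝ) - 2) * p := by
    calc _ ≤ 3 / ((n : ℝ) * ((n : ℝ) - 1) * ((n : ℝ) - 2)) * (n * (n - 1) * p) := by gcongr
      _ = _ := by field_simp
  calc _ ≤ _ := add_le_add (add_le_add le_rfl e1) e2
    _ = _ := by simp only [Pi.sub_apply]; ring

end Deterministic

/-! ### Conditional centring of a kernel of independent variables -/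

section Kernel

variable {Ω E : Type*} [MeasurableSpace Ω] [MeasurableSpace E] {P : Measure Ω}
  [IsProbabilityMeasure P] {μ : Measure E} [IsProbabilityMeasure μ]

theorem condExp_comap_eq_integral [StandardBorelSpace E] [Nonempty E] {Y Z : Ω → E}
    (hY : Measurable Y) (hZ : Measurable Z) (hYZ : IndepFun Y Z P) (hlaw : P.map Z = μ)
    {f : E × E → ℝ} (hf : Measurable f) {C : ℝ} (hC : ∀ z, |f z| ≤ C) :
    P[fun ω => f (Y ω, Z ω) | MeasurableSpace.comap Y inferInstance] =ᵐ[P]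
      fun ω => ∫ z, f (Y ω, z) ∂μ := by
  have hcond : condDistrib Z Y P =ᵐ[P.map Y] ProbabilityTheory.Kernel.const E μ := by
    refine condDistrib_ae_eq_of_measure_eq_compProd Y hZ.aemeasurable ?_
    rw [Measure.compProd_const, hYZ.map_prod_eq_prod_map_map hY.aemeasurable hZ.aemeasurable, hlaw]
  refine (condExp_prod_ae_eq_integral_condDistrib hY hZ.aemeasurable hf.stronglyMeasurable
    (Integrable.of_bound (hf.comp (hY.prodMk hZ)).aestronglyMeasurable C
      (ae_of_all _ fun ω => hC _))).trans ?_
  filter_upwards [ae_of_ae_map hY.aemeasurable hcond] with ω hω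
  rw [hω, ProbabilityTheory.Kernel.const_apply]

variable {n : ℕ} {X : Fin n → Ω → E}

/-- Off-diagonal terms vanish: conditionally on `X i`, the variables `h (X i, X k)` and
`h (X i, X l)` are independent and centred. -/
theorem integral_mul_eq_zero_of_centred (hX : ∀ i, Measurable (X i)) (hindep : iIndepFun X P)
    (hlaw : ∀ i, P.map (X i) = μ) {h : E × E → ℝ} (hh : Measurable h) {C : ℝ}
    (hC : ∀ z, |h z| ≤ C) (hzero : ∀ x, ∫ z, h (x, z) ∂μ = 0) {i k l : Fin n} (hil : i ≠ l)
    (hkl : k ≠ l) :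
    ∫ ω, h (X i ω, X k ω) * h (X i ω, X l ω) ∂P = 0 := by
  have hmap := (hindep.indepFun_prodMk hX i k l hil hkl).map_prod_eq_prod_map_map
    ((hX i).prodMk (hX k)).aemeasurable (hX l).aemeasurable
  let H : (E × E) × E → ℝ := fun z => h z.1 * h (z.1.1, z.2)
  have hH : Measurable H := by fun_prop
  have : IsProbabilityMeasure (P.map fun ω => (X i ω, X k ω)) :=
    Measure.isProbabilityMeasure_map ((hX i).prodMk (hX k)).aemeasurable
  have hint : Integrable H ((P.map fun ω => (X i ω, X k ω)).prod μ) :=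
    Integrable.of_bound hH.aestronglyMeasurable (C * C) (ae_of_all _ fun z => by
      rw [Real.norm_eq_abs, abs_mul]
      exact mul_le_mul (hC _) (hC _) (abs_nonneg _) ((abs_nonneg _).trans (hC z.1)))
  rw [hlaw] at hmap
  calc ∫ ω, h (X i ω, X k ω) * h (X i ω, X l ω) ∂P
      = ∫ z, H z ∂(P.map fun ω => ((X i ω, X k ω), X l ω)) :=
        (integral_map (((hX i).prodMk (hX k)).prodMk (hX l)).aemeasurable
          hH.aestronglyMeasurable).symm
    _ = 0 := by
        rw [hmap, integral_prod _ hint]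
        simp [H, integral_const_mul, hzero]

/-- A sum over `k ≠ i` of conditionally centred terms has second moment of order `n`, not `n²`. -/
theorem integral_sum_sq_le_of_centred (hX : ∀ i, Measurable (X i)) (hindep : iIndepFun X P)
    (hlaw : ∀ i, P.map (X i) = μ) {h : E × E → ℝ} (hh : Measurable h) {C : ℝ}
    (hC : ∀ z, |h z| ≤ C) (hzero : ∀ x, ∫ z, h (x, z) ∂μ = 0) (i : Fin n) :
    ∫ ω, (∑ k ∈ Finset.univ.erase i, h (X i ω, X k ω)) ^ 2 ∂P ≤
      (Finset.univ.erase i).card * C ^ 2 := by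
  have hmeas : ∀ k, Measurable fun ω => h (X i ω, X k ω) := fun k =>
    hh.comp ((hX i).prodMk (hX k))
  have hbound : ∀ k l ω, |h (X i ω, X k ω) * h (X i ω, X l ω)| ≤ C ^ 2 := fun k l ω => by
    rw [abs_mul, sq]
    exact mul_le_mul (hC _) (hC _) (abs_nonneg _) ((abs_nonneg _).trans (hC (X i ω, X k ω)))
  have hint : ∀ k l, Integrable (fun ω => h (X i ω, X k ω) * h (X i ω, X l ω)) P := fun k l =>
    Integrable.of_bound ((hmeas k).mul (hmeas l)).aestronglyMeasurable (C ^ 2)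
      (ae_of_all _ fun ω => hbound k l ω)
  simp_rw [sq (∑ k ∈ _, _), Finset.sum_mul_sum]
  rw [integral_finsetSum _ fun k _ => integrable_finsetSum _ fun l _ => hint k l, ← nsmul_eq_mul]
  refine Finset.sum_le_card_nsmul _ _ _ fun k hk => ?_
  rw [integral_finsetSum _ fun l _ => hint k l, Finset.sum_eq_single_of_mem k hk fun l hl hlk =>
    integral_mul_eq_zero_of_centred hX hindep hlaw hh hC hzero (Finset.ne_of_mem_erase hl).symm
      hlk.symm]
  calc ∫ ω, h (X i ω, X k ω) * h (X i ω, X k ω) ∂P ≤ ∫ _ω, C ^ 2 ∂P :=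
        integral_mono (hint k k) (integrable_const _) fun ω => (le_abs_self _).trans (hbound k k ω)
    _ = C ^ 2 := by simp

end Kernel

/-! ### Row means of signs approximate their conditional expectations -/

section Signs

theorem abs_sign_le_one (r : ℝ) : |Real.sign r| ≤ 1 := by
  rcases Real.sign_apply_eq r with h | h | h <;> simp [h]

theorem measurable_real_sign : Measurable Real.sign :=
  Measurable.ite measurableSet_Iio measurable_const
    (Measurable.ite measurableSet_Ioi measurable_const measurable_const)

variable {Ω : Type*} {n p : ℕ} {μ : Measure (EuclideanSpace ℝ (Fin p))}
  {X : Fin n → Ω → EuclideanSpace ℝ (Fin p)}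

/-- The mean sign `∫ sign (x_j - z_j) dμ(z)`, a version of `E[A_{ik} | X_i = x]`. -/
noncomputable def meanSign (μ : Measure (EuclideanSpace ℝ (Fin p)))
    (x : EuclideanSpace ℝ (Fin p)) (j : Fin p) : ℝ :=
  ∫ z, Real.sign (x j - z j) ∂μ

/-- The total squared error of the row means. -/
noncomputable def rowError (μ : Measure (EuclideanSpace ℝ (Fin p)))
    (X : Fin n → Ω → EuclideanSpace ℝ (Fin p)) (ω : Ω) : ℝ :=
  ∑ i, ∑ j, (rowMean (fun i k => signVec X i k ω) i j - meanSign μ (X i ω) j) ^ 2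

theorem rowError_nonneg (ω : Ω) : 0 ≤ rowError μ X ω := by
  unfold rowError; positivity

/-- The error of a row mean is an average of conditionally centred terms. -/
theorem rowMean_sub_meanSign (hn : 2 ≤ n) (ω : Ω) (i : Fin n) (j : Fin p) :
    rowMean (fun i k => signVec X i k ω) i j - meanSign μ (X i ω) j =
      (∑ k ∈ Finset.univ.erase i,
        (Real.sign (X i ω j - X k ω j) - meanSign μ (X i ω) j)) / ((n : ℝ) - 1) := by
  have hn' : (2 : ℝ) ≤ n := by exact_mod_cast hn
  have h1 : (n : ℝ) - 1 ≠ 0 := by linarith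
  rw [Finset.sum_sub_distrib, Finset.sum_const, Finset.card_erase_of_mem (Finset.mem_univ i),
    Finset.card_univ, Fintype.card_fin, nsmul_eq_mul, Nat.cast_pred (by omega), sub_div,
    mul_div_cancel_left₀ _ h1]
  rfl

theorem measurable_sign_sub (j : Fin p) :
    Measurable fun z : EuclideanSpace ℝ (Fin p) × EuclideanSpace ℝ (Fin p) =>
      Real.sign (z.1 j - z.2 j) :=
  measurable_real_sign.comp (by fun_prop)

variable [MeasurableSpace Ω] {P : Measure Ω} [IsProbabilityMeasure P] [IsProbabilityMeasure μ]

theorem measurable_meanSign (j : Fin p) : Measurable fun x => meanSign μ x j :=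
  (measurable_sign_sub j).stronglyMeasurable.integral_prod_right'.measurable

theorem abs_meanSign_le_one (x : EuclideanSpace ℝ (Fin p)) (j : Fin p) : |meanSign μ x j| ≤ 1 := by
  simpa [meanSign] using norm_integral_le_of_norm_le_const (μ := μ) (C := 1)
    (f := fun z => Real.sign (x j - z j)) (ae_of_all _ fun z => abs_sign_le_one _)

theorem condSignVec_ae_eq (hX : ∀ i, Measurable (X i)) (hindep : iIndepFun X P)
    (hlaw : ∀ i, P.map (X i) = μ) {κ : Fin n → Fin n} (hκ : ∀ i, κ i ≠ i) :
    ∀ᵐ ω ∂P, ∀ i, condSignVec P X i (κ i) ω = meanSign μ (X i ω) := by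
  rw [ae_all_iff]
  intro i
  have : ∀ᵐ ω ∂P, ∀ j, condSignVec P X i (κ i) ω j = meanSign μ (X i ω) j := by
    rw [ae_all_iff]
    exact fun j => condExp_comap_eq_integral (hX i) (hX (κ i)) (hindep.indepFun (hκ i).symm)
      (hlaw _) (measurable_sign_sub j) fun z => abs_sign_le_one _
  filter_upwards [this] with ω hω using funext hω

theorem integrable_sq_rowMean_sub (hn : 2 ≤ n) (hX : ∀ i, Measurable (X i)) (i : Fin n)
    (j : Fin p) :
    Integrable (fun ω =>
      (rowMean (fun i k => signVec X i k ω) i j - meanSign μ (X i ω) j) ^ 2) P := by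
  simp_rw [rowMean_sub_meanSign hn, div_pow]
  refine Integrable.div_const (Integrable.of_bound (Measurable.aestronglyMeasurable ?_)
    (((Finset.univ.erase i).card * 2) ^ 2) (ae_of_all _ fun ω => ?_)) _
  · refine (Finset.measurable_sum _ fun k _ => Measurable.sub ?_ ?_).pow_const 2
    · exact (measurable_sign_sub j).comp ((hX i).prodMk (hX k))
    · exact (measurable_meanSign j).comp (hX i)
  · rw [Real.norm_eq_abs, abs_pow]
    gcongr
    refine (Finset.abs_sum_le_sum_abs _ _).trans ?_
    rw [← nsmul_eq_mul]
    refine Finset.sum_le_card_nsmul _ _ _ fun k _ => (abs_sub _ _).trans ?_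
    linarith [abs_sign_le_one (X i ω j - X k ω j), abs_meanSign_le_one (μ := μ) (X i ω) j]

theorem integrable_rowError (hn : 2 ≤ n) (hX : ∀ i, Measurable (X i)) :
    Integrable (rowError μ X) P :=
  integrable_finsetSum _ fun i _ => integrable_finsetSum _ fun j _ =>
    integrable_sq_rowMean_sub hn hX i j

/-- Each of the `n p` row means has mean squared error at most `4 / (n - 1)`. -/
theorem integral_rowError_le (hn : 2 ≤ n) (hX : ∀ i, Measurable (X i)) (hindep : iIndepFun X P)
    (hlaw : ∀ i, P.map (X i) = μ) :
    ∫ ω, rowError μ X ω ∂P ≤ n * p * (4 / ((n : ℝ) - 1)) := by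
  have hn' : (2 : ℝ) ≤ n := by exact_mod_cast hn
  have h1 : 0 < (n : ℝ) - 1 := by linarith
  have hterm : ∀ i j, ∫ ω, (rowMean (fun i k => signVec X i k ω) i j -
      meanSign μ (X i ω) j) ^ 2 ∂P ≤ 4 / ((n : ℝ) - 1) := fun i j => by
    have hle := integral_sum_sq_le_of_centred hX hindep hlaw
      (h := fun z => Real.sign (z.1 j - z.2 j) - meanSign μ z.1 j)
      ((measurable_sign_sub j).sub ((measurable_meanSign j).comp measurable_fst)) (C := 2)
      (fun z => (abs_sub _ _).trans (by
        linarith [abs_sign_le_one (z.1 j - z.2 j), abs_meanSign_le_one (μ := μ) z.1 j]))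
      (fun x => by
        have hint : Integrable (fun z : EuclideanSpace ℝ (Fin p) => Real.sign (x j - z j)) μ :=
          Integrable.of_bound ((measurable_sign_sub j).comp
            measurable_prodMk_left).aestronglyMeasurable 1 (ae_of_all _ fun z => abs_sign_le_one _)
        refine (integral_sub hint (integrable_const (meanSign μ x j))).trans ?_
        simp [meanSign]) i
    rw [Finset.card_erase_of_mem (Finset.mem_univ i), Finset.card_univ, Fintype.card_fin,
      Nat.cast_pred (by omega)] at hle
    simp_rw [rowMean_sub_meanSign hn, div_pow]
    rw [integral_div, div_le_div_iff₀ (by positivity) h1]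
    nlinarith
  have hsum : ∫ ω, rowError μ X ω ∂P = ∑ i, ∑ j, ∫ ω,
      (rowMean (fun i k => signVec X i k ω) i j - meanSign μ (X i ω) j) ^ 2 ∂P := by
    unfold rowError
    rw [integral_finsetSum _ fun i _ => integrable_finsetSum _ fun j _ =>
      integrable_sq_rowMean_sub hn hX i j]
    exact Finset.sum_congr rfl fun i _ => integral_finsetSum _ fun j _ =>
      integrable_sq_rowMean_sub hn hX i j
  rw [hsum]
  calc _ ≤ ∑ _i : Fin n, ∑ _j : Fin p, 4 / ((n : ℝ) - 1) :=
        Finset.sum_le_sum fun i _ => Finset.sum_le_sum fun j _ => hterm i j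
    _ = _ := by simp [mul_assoc]

/-! ### The probability of a large Lévy distance -/

/-- The choice `t = √n` in `sum_abs_dotProduct_sub_mulVec_le` balances its two main terms. -/
theorem measure_levyDist_ge_le (hn : 3 ≤ n) (hp : 0 < p) (hX : ∀ i, Measurable (X i))
    (hindep : iIndepFun X P) (hlaw : ∀ i, P.map (X i) = μ) {κ : Fin n → Fin n}
    (hκ : ∀ i, κ i ≠ i) {ε : ℝ} (hε : 0 < ε)
    (hsmall : 3 / √(n : ℝ) + 6 / ((n : ℝ) - 2) ≤ ε ^ 2 / 8) :
    P {ω | ε ≤ levyDist (esd (improvedSpearman_isHermitian X ω))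
      (esd (projMatrix_isHermitian P X κ ω))} ≤
      ENNReal.ofReal (96 / ε ^ 2 * ((1 + √(n : ℝ)) / ((n : ℝ) - 1))) := by
  have hn' : (3 : ℝ) ≤ n := by exact_mod_cast hn
  have h0 : 0 < (n : ℝ) := by linarith
  have h1 : 0 < (n : ℝ) - 1 := by linarith
  have hp' : 0 < (p : ℝ) := by exact_mod_cast hp
  have ht : 0 < √(n : ℝ) := Real.sqrt_pos.2 h0
  -- the row error at which the first term of the trace norm bound reaches half of `(ε / 2)² p`
  set s : ℝ := ε ^ 2 * n * p / (24 * (1 + √(n : ℝ))) with hs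
  have hs0 : 0 < s := by positivity
  have hsub : ∀ᵐ ω ∂P, ε ≤ levyDist (esd (improvedSpearman_isHermitian X ω))
      (esd (projMatrix_isHermitian P X κ ω)) → s ≤ rowError μ X ω := by
    filter_upwards [condSignVec_ae_eq hX hindep hlaw hκ] with ω hω hlevy
    by_contra! hlt
    have hD := (improvedSpearman_isHermitian X ω).sub (projMatrix_isHermitian P X κ ω)
    have hbound := sum_abs_dotProduct_sub_mulVec_le hn (fun i k => signVec X i k ω)
      (fun i k l => abs_sign_le_one _) (fun i => condSignVec P X i (κ i) ω)
      hD.eigenvectorBasis ht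
    have herr : ∑ i, ∑ j, (rowMean (fun i k => signVec X i k ω) i j -
        condSignVec P X i (κ i) ω j) ^ 2 = rowError μ X ω := by
      simp only [hω, rowError]
    rw [herr] at hbound
    have hmain : (3 / (n : ℝ)) * (1 + √(n : ℝ)) * rowError μ X ω ≤ ε ^ 2 / 8 * p := by
      calc _ ≤ (3 / (n : ℝ)) * (1 + √(n : ℝ)) * s := by gcongr
        _ = _ := by rw [hs]; field_simp; norm_num
    have hrest : (3 / √(n : ℝ) + 6 / ((n : ℝ) - 2)) * p ≤ ε ^ 2 / 8 * p := by gcongr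
    have := levyDist_esd_le (improvedSpearman_isHermitian X ω) (projMatrix_isHermitian P X κ ω) hD
      (half_pos hε) (hbound.trans (by linarith))
    linarith
  have hmarkov := mul_meas_ge_le_integral_of_nonneg (μ := P)
    (ae_of_all _ fun ω => rowError_nonneg (μ := μ) (X := X) ω)
    (integrable_rowError (by omega) hX) s
  have hreal : P.real {ω | s ≤ rowError μ X ω} ≤
      96 / ε ^ 2 * ((1 + √(n : ℝ)) / ((n : ℝ) - 1)) := by
    refine le_of_mul_le_mul_left (hmarkov.trans
      ((integral_rowError_le (by omega) hX hindep hlaw).trans_eq ?_)) hs0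
    rw [hs]; field_simp; norm_num
  calc _ ≤ P {ω | s ≤ rowError μ X ω} := measure_mono_ae hsub
    _ = ENNReal.ofReal (P.real {ω | s ≤ rowError μ X ω}) :=
        (ENNReal.ofReal_toReal (measure_ne_top _ _)).symm
    _ ≤ _ := ENNReal.ofReal_le_ofReal hreal

end Signs

theorem tendsto_one_add_sqrt_div_sub_one :
    Tendsto (fun n : ℕ => (1 + √(n : ℝ)) / ((n : ℝ) - 1)) atTop (𝓝 0) := by
  have hsqrt : Tendsto (fun n : ℕ => √(n : ℝ) - 1) atTop atTop :=
    tendsto_atTop_add_const_right _ _ (Real.tendsto_sqrt_atTop.comp tendsto_natCast_atTop_atTop)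
  refine (tendsto_inv_atTop_zero.comp hsqrt).congr' ?_
  filter_upwards [hsqrt.eventually_gt_atTop 0] with n hn
  -- `(1 + √n) / (n - 1) = (√n - 1)⁻¹`
  have hfactor : (n : ℝ) - 1 = (1 + √(n : ℝ)) * (√(n : ℝ) - 1) := by
    nlinarith [Real.sq_sqrt (Nat.cast_nonneg (α := ℝ) n)]
  have : (1 + √(n : ℝ)) ≠ 0 := by positivity
  rw [hfactor, Function.comp_apply, div_mul_cancel_left₀ this]

end SpearmanLSD

theorem mainTheorem3
    {Ω : ℕ → Type*} [∀ n, MeasurableSpace (Ω n)]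
    (P : ∀ n, Measure (Ω n)) [∀ n, IsProbabilityMeasure (P n)]
    (p : ℕ → ℕ)
    (S : ∀ n, Matrix (Fin (p n)) (Fin (p n)) ℝ)
    (hS : ∀ n, (S n).PosSemidef)
    (hdiag : ∀ n j, S n j j = 1)
    (X : ∀ n, Fin n → Ω n → EuclideanSpace ℝ (Fin (p n)))
    (hmeas : ∀ n i, Measurable (X n i))
    (hindep : ∀ n, iIndepFun (X n) (P n))
    (hlaw : ∀ n i, (P n).map (X n i) = multivariateGaussian 0 (S n))
    (κ : ∀ n, Fin n → Fin n)
    (hκ : ∀ n, 2 ≤ n → ∀ i, κ n i ≠ i)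
    (y : ℝ) (hy : 0 < y)
    (hratio : Tendsto (fun n : ℕ => (p n : ℝ) / (n : ℝ)) atTop (𝓝 y))
    (htrace : (fun n : ℕ => (S n ^ 2).trace) =o[atTop] fun n : ℕ => (p n : ℝ) ^ 2) :
    ∀ ε : ℝ, 0 < ε →
      Tendsto
        (fun n : ℕ => P n {ω : Ω n | ε ≤ SpearmanLSD.levyDist
          (SpearmanLSD.esd (SpearmanLSD.improvedSpearman_isHermitian (X n) ω))
          (SpearmanLSD.esd (SpearmanLSD.projMatrix_isHermitian (P n) (X n) (κ n) ω))})
        atTop (𝓝 0) := by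
  intro ε hε
  have hbig : ∀ᶠ n : ℕ in atTop, 3 / √(n : ℝ) + 6 / ((n : ℝ) - 2) ≤ ε ^ 2 / 8 := by
    have hsqrt : Tendsto (fun n : ℕ => 3 / √(n : ℝ)) atTop (𝓝 0) :=
      tendsto_const_nhds.div_atTop (Real.tendsto_sqrt_atTop.comp tendsto_natCast_atTop_atTop)
    have hsub : Tendsto (fun n : ℕ => 6 / ((n : ℝ) - 2)) atTop (𝓝 0) :=
      tendsto_const_nhds.div_atTop
        (tendsto_atTop_add_const_right _ _ tendsto_natCast_atTop_atTop)
    have hsum := hsqrt.add hsub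
    rw [add_zero] at hsum
    exact hsum.eventually_le_const (by positivity)
  have hlim : Tendsto (fun n : ℕ => ENNReal.ofReal
      (96 / ε ^ 2 * ((1 + √(n : ℝ)) / ((n : ℝ) - 1)))) atTop (𝓝 0) := by
    simpa using ENNReal.tendsto_ofReal
      (SpearmanLSD.tendsto_one_add_sqrt_div_sub_one.const_mul (96 / ε ^ 2))
  refine tendsto_of_tendsto_of_tendsto_of_le_of_le' tendsto_const_nhds hlim
    (Eventually.of_forall fun n => zero_le) ?_
  filter_upwards [hbig, eventually_ge_atTop 3, hratio.eventually_const_lt hy] with n hsmall hn hpn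
  have hp : 0 < p n := Nat.pos_of_ne_zero fun h => by simp [h] at hpn
  exact SpearmanLSD.measure_levyDist_ge_le hn hp (hmeas n) (hindep n) (hlaw n)
    (hκ n (by omega)) hε hsmall
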